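/- **Setting.** Formulae are $A ::= a \mid \bar a \mid \top \mid \bot \mid A\land A \mid A\lor A$, and $\bar A$ is the De Morgan dual of $A$. A *type* is a formula or a *witness type* $[a]$, $[\bar a]$ or $A\otimes B$, with underlying formula $a$, $\bar a$, $A\land B$ respectively (a formula is its own underlying formula). *Expansion trees* $t$ and *witnesses* $w$ over a set of wire symbols are given by $$t ::= 1 \mid (w+\dots+w) \mid (t\lor t)\mid (t\lor *)\mid (*\lor t),\qquad w ::= x\mid\bar x\mid t\otimes t ,$$ where $(w+\dots+w)$ is a nonempty unordered formal sum, called an *expansion*. They are typed by: $1:\top$; $x:[p]$; $\bar x:[\bar p]$; $t\otimes s: A\otimes B$ and $t\lor s:A\lor B$ if $t:A$, $s:B$; $t\lor *:A\lor B$ if $t:A$; $*\lor t:A\lor B$ if $t:B$; and $(w_1+\dots+w_n):A$ if all $w_i$ have the same witness type, with underlying formula $A$. A *cut* $t\bowtie s$ is an unordered pair of expansion trees $t:A$, $s:\bar A$ with $A\neq\top,\bot$. A *typed forest* is a finite forest of typed expansion trees, typed witnesses and cuts, considered as a forest of nodes whose roots are the roots of these trees, in which each wire variable occurs at most once, and $x$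 occurs if and only if $\bar x$ occurs. Its *type* is the family of the types of its roots that are not cuts. A *closure* of a family of types $\Gamma$ is a family $\Gamma'$ for which there is an injection from the members of $\Gamma'$ to those of $\Gamma$ such that each member of $\Gamma'$ equals its image or the underlying formula of its image. A node is *switched* if it is an expansion or a node $t\lor s$ with $t,s\ne *$. A *switching* $\sigma$ chooses a successor (immediate subtree) of every switched node. The *switching graph* of $\sigma$ is the undirected graph on the nodes whose edges join $x$ to $\bar x$ and every non-root node to its predecessor, except that a switched node is joined only to the successor chosen by $\sigma$. A typed forest is *AC* if all its switching graphs are acyclic. A *switching path* is a (simple) path in some switching graph. A *subnet* of an AC typed forest is a nonempty set of nodes that is closed under successors, contains $x$ if and only if it contains $\bar x$, contains the predecessor of each $*$ that it contains, and contains every node of every switching path between two of its roots; its roots are its nodes that have no predecessor in it. **Proposition.** Let $G = F,\ s\bowtie t$ be an AC typed forest, where $s$ is a nontrivial expansion, and let the witnesses of $s$ be partitioned into two nonempty sets, so that $s=s_1+s_2$ with expansions $s_1$ and $s_2$. Let $E$ be a subnet of $G$ that has $t$ as a root and whose other roots are all either witnesses $w_1,\dots,w_n$ or cuts $c_1,\dots,c_m$.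 Take two copies $E^L$, $E^R$ of $E$ in which every wire symbol $x$ is replaced by $x^L$, respectively $x^R$, where all of these are distinct and do not occur in $G$. Let $F'$ be obtained from $F$ by replacing $E$ by the two copies as follows: if $w_i$ is a successor of an expansion outside $E$, it is replaced in that sum by the two summands $w_i^L+w_i^R$; if $w_i$ is a root of $G$, it is replaced by the root $(w_i^L+w_i^R)$, typed by the underlying formula of the type of $w_i$; and each cut $c_j$ is replaced by the two cuts $c_j^L$, $c_j^R$. Then $$G' = F',\ s_1\bowtie t^L,\ s_2\bowtie t^R$$ is an AC typed forest, and the type of $G'$ is a closure of the type of $G$. Moreover, if in $G$ the two ends of every axiom link have dual types (that is, $x:[p]$ and $\bar x:[\bar p]$ with the same $p$), then the same holds in $G'$. -/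

import Mathlib

namespace ExpansionNet

/-- Formulae of classical propositional logic over a set `P` of proposition symbols. -/
inductive Formula (P : Type*) where
  | atom (p : P)
  | natom (p : P)
  | top
  | bot
  | and (A B : Formula P)
  | or (A B : Formula P)

/-- De Morgan dual. -/
def Formula.dual {P : Type*} : Formula P → Formula P
  | .atom p => .natom p
  | .natom p => .atom p
  | .top => .bot
  | .bot => .top
  | .and A B => .or A.dual B.dual
  | .or A B => .and A.dual B.dual

/-- Types: formulae, and the three forms of witness type `[p]`, `[p̄]`, `A ⊗ B`. -/
inductive Ty (P : Type*) where
  | formula (A : Formula P)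
  | posWit (p : P)
  | negWit (p : P)
  | tensorWit (A B : Formula P)

def Ty.IsWitness {P : Type*} : Ty P → Prop
  | .formula _ => False
  | _ => True

/-- The underlying classical formula of a type. -/
def Ty.underlying {P : Type*} : Ty P → Formula P
  | .formula A => A
  | .posWit p => .atom p
  | .negWit p => .natom p
  | .tensorWit A B => .and A B

/-- The dual of an atomic witness type. -/
def Ty.AtomDual {P : Type*} : Ty P → Ty P → Prop
  | .posWit p, .negWit q => p = q
  | _, _ => False

/-- What a node of the parse tree of an expansion tree, witness or cut can be.
`pos x` and `neg x` are the wire variables `x` and `x̄`; `star` is the symbol `*` of a default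
weakening `t ∨ *` or `* ∨ t`; `plus` is a formal sum (an expansion); `cut` is `t ⋈ s`. -/
inductive Label (W : Type*) where
  | one
  | star
  | pos (x : W)
  | neg (x : W)
  | plus
  | or
  | tensor
  | cut

/-- Renaming of wire symbols in a label. -/
def Label.rename {W : Type*} (ρ : W → W) : Label W → Label W
  | .pos x => .pos (ρ x)
  | .neg x => .neg (ρ x)
  | l => l

/-- The label of the root of a witness. -/
def Label.IsWitness {W : Type*} : Label W → Prop
  | .pos _ => True
  | .neg _ => True
  | .tensor => True
  | _ => False

/-- Raw data of a forest with node set `V`, labels and type annotations.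
`pr` is the partial predecessor function (roots have predecessor `none`).
`idx` orders the successors of the ordered nodes `∨` and `⊗` (left is `0`, right is `1`);
it is not read at other nodes, so that sums and cuts are unordered.
`ty` gives the type of each node; instances of `*` and cuts have no type. -/
structure LabelledForest (P W V : Type*) where
  pr : V → Option V
  label : V → Label W
  idx : V → ℕ
  ty : V → Option (Ty P)

namespace LabelledForest

variable {P W V : Type*} (F : LabelledForest P W V)

def IsRoot (v : V) : Prop := F.pr v = none

/-- The set of successors of a node. -/
def succs (v : V) : Set V := {u | F.pr u = some v}

/-- Every node reaches a root by iterating the predecessor function. -/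
def IsForest : Prop :=
  ∀ v, ∃ r, Relation.ReflTransGen (fun a b => F.pr a = some b) v r ∧ F.IsRoot r

/-- `v` is an ordered binary node with left successor `l` and right successor `r`. -/
def Binary (v l r : V) : Prop :=
  F.succs v = {l, r} ∧ F.idx l = 0 ∧ F.idx r = 1

/-- The node `v` is an instance of one of the formation and typing rules for propositional
expansion trees, witnesses and cut trees (cuts occur only as roots, `*` never as a root). -/
inductive WellTypedAt (v : V) : Prop
  | one : F.label v = .one → F.succs v = ∅ → F.ty v = some (.formula .top) → WellTypedAt v
  | pos (x : W) (p : P) : F.label v = .pos x → F.succs v = ∅ →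
      F.ty v = some (.posWit p) → WellTypedAt v
  | neg (x : W) (p : P) : F.label v = .neg x → F.succs v = ∅ →
      F.ty v = some (.negWit p) → WellTypedAt v
  | tensor (l r : V) (A B : Formula P) : F.label v = .tensor → F.Binary v l r →
      F.ty l = some (.formula A) → F.ty r = some (.formula B) →
      F.ty v = some (.tensorWit A B) → WellTypedAt v
  | plus (τ : Ty P) : F.label v = .plus → (F.succs v).Nonempty → τ.IsWitness →
      (∀ u ∈ F.succs v, F.ty u = some τ) →
      F.ty v = some (.formula τ.underlying) → WellTypedAt v
  | or (l r : V) (A B : Formula P) : F.label v = .or → F.Binary v l r →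
      F.ty l = some (.formula A) → F.ty r = some (.formula B) →
      F.ty v = some (.formula (.or A B)) → WellTypedAt v
  | orStar (l r : V) (A B : Formula P) : F.label v = .or → F.Binary v l r →
      F.ty l = some (.formula A) → F.label r = .star →
      F.ty v = some (.formula (.or A B)) → WellTypedAt v
  | starOr (l r : V) (A B : Formula P) : F.label v = .or → F.Binary v l r →
      F.label l = .star → F.ty r = some (.formula B) →
      F.ty v = some (.formula (.or A B)) → WellTypedAt v
  | star : F.label v = .star → F.succs v = ∅ → ¬ F.IsRoot v → F.ty v = none → WellTypedAt v
  | cut (l r : V) (A : Formula P) : F.label v = .cut → F.IsRoot v → l ≠ r →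
      F.succs v = {l, r} → F.ty l = some (.formula A) → F.ty r = some (.formula A.dual) →
      A ≠ .top → A ≠ .bot → F.ty v = none → WellTypedAt v

/-- Typed forests (with cuts): finite forests of typed propositional expansion trees, witnesses
and cut trees in which wire variables occur at most once and in dual pairs. -/
structure IsTypedForest : Prop where
  finite : Finite V
  forest : F.IsForest
  wellTyped : ∀ v, F.WellTypedAt v
  pos_unique : ∀ u v x, F.label u = .pos x → F.label v = .pos x → u = v
  neg_unique : ∀ u v x, F.label u = .neg x → F.label v = .neg x → u = v
  paired : ∀ x, (∃ v, F.label v = .pos x) ↔ (∃ v, F.label v = .neg x)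

/-- The two ends of every axiom link carry dual types. -/
def DualWireTypes : Prop :=
  ∀ u v x, F.label u = .pos x → F.label v = .neg x →
    ∃ σ τ, F.ty u = some σ ∧ F.ty v = some τ ∧ σ.AtomDual τ

/-- Switched nodes: expansions, and disjunctions `t ∨ s` with neither `t` nor `s` equal to `*`. -/
def Switched (v : V) : Prop :=
  F.label v = .plus ∨ (F.label v = .or ∧ ∀ u ∈ F.succs v, F.label u ≠ .star)

/-- A switching chooses a successor of each switched node (values elsewhere are not used). -/
def IsSwitching (σ : V → V) : Prop := ∀ v, F.Switched v → σ v ∈ F.succs v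

/-- Directed edges of the graph of the forest that are kept by the switching `σ`. -/
def SwitchEdge (σ : V → V) (a b : V) : Prop :=
  (F.pr a = some b ∧ (F.Switched b → σ b = a)) ∨
    ∃ x, F.label a = .pos x ∧ F.label b = .neg x

/-- The switching graph `σ(F)`. -/
def switchingGraph (σ : V → V) : SimpleGraph V := SimpleGraph.fromRel (F.SwitchEdge σ)

/-- AC-correctness: every switching graph is acyclic. -/
def AC : Prop := ∀ σ, F.IsSwitching σ → (F.switchingGraph σ).IsAcyclic

/-- `v` is a root of the subforest with node set `E`. -/
def IsRootOf (E : Set V) (v : V) : Prop := v ∈ E ∧ ∀ u ∈ E, F.pr v ≠ some u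

/-- Substructures: non-empty sets of nodes closed under successors, axiom links and default
attachment. -/
structure IsSubstructure (E : Set V) : Prop where
  nonempty : E.Nonempty
  upward : ∀ u v, F.pr u = some v → v ∈ E → u ∈ E
  links : ∀ u v x, F.label u = .pos x → F.label v = .neg x → (u ∈ E ↔ v ∈ E)
  attachment : ∀ u v, F.label u = .star → F.pr u = some v → u ∈ E → v ∈ E

/-- Subnets: substructures `E` such that every switching path between two roots of `E` lies
inside `E`. -/
def IsSubnet (E : Set V) : Prop :=
  F.IsSubstructure E ∧
    ∀ σ, F.IsSwitching σ → ∀ x y, F.IsRootOf E x → F.IsRootOf E y →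
      ∀ p : (F.switchingGraph σ).Walk x y, p.IsPath → ∀ z ∈ p.support, z ∈ E

/-- The roots that carry a type, i.e. the roots that are not cuts. The type of the forest is the
family of types of these roots. -/
def TypedRoot : Type _ := {v : V // F.IsRoot v ∧ F.label v ≠ .cut}

/-- The type of `F'` is a closure of the type of `F`: there is an injection from the roots of the
former to those of the latter that preserves types or replaces a type by its underlying formula. -/
def ClosureOf {V' : Type*} (F' : LabelledForest P W V') (F : LabelledForest P W V) : Prop :=
  ∃ f : F'.TypedRoot → F.TypedRoot, Function.Injective f ∧
    ∀ r : F'.TypedRoot, ∃ τ' τ : Ty P, F'.ty r.1 = some τ' ∧ F.ty (f r).1 = some τ ∧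
      (τ' = τ ∨ τ' = .formula τ.underlying)

end LabelledForest

/-- The two tags of duplicated material. -/
inductive Side where
  | L
  | R

/-- The wire symbol `x` occurs in the set `E` of nodes of `F`. -/
def LabelledForest.WireIn {P W V : Type*} (F : LabelledForest P W V) (E : Set V) (x : W) : Prop :=
  ∃ v ∈ E, F.label v = .pos x ∨ F.label v = .neg x

/-- `ρ` provides, for each wire symbol `x` of `E`, two symbols `x^L`, `x^R` that do not occur
in `F`, all of these being different. -/
structure IsFreshRenaming {P W V : Type*} (F : LabelledForest P W V) (E : Set V)
    (ρ : Side → W → W) : Prop where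
  fresh : ∀ b x, F.WireIn E x → ¬ F.WireIn Set.univ (ρ b x)
  inj : ∀ b c x y, F.WireIn E x → F.WireIn E y → ρ b x = ρ c y → b = c ∧ x = y

section Contraction

variable {P W V : Type*} (G : LabelledForest P W V) (X s : V) (S₁ E : Set V) (ρ : Side → W → W)

/-- The nodes that occur twice in the reduct: those of the duplicated subnet, the expansion `s`
(which is split into two expansions) and the cut `X`. -/
def Doubled (X s : V) (E : Set V) : Set V := E ∪ {X, s}

/-- The roots of the whole forest that are witnesses in the duplicated subnet. -/
def RootWitness (E : Set V) : Set V := {w | w ∈ E ∧ G.IsRoot w ∧ (G.label w).IsWitness}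

/-- Nodes of the reduct: the nodes outside the doubled part; a left and a right copy of each
doubled node; and, for every root witness `w` of the subnet, a new expansion `(w^L + w^R)`. -/
inductive ContrNode
  | keep (v : V) (h : v ∉ Doubled X s E)
  | copy (b : Side) (v : V) (h : v ∈ Doubled X s E)
  | sum (w : V) (h : w ∈ RootWitness G E)

open Classical in
/-- The node that stands for `v` in the reduct, as seen from a node tagged `b`. -/
noncomputable def contrPlace (b : Side) (v : V) : ContrNode G X s E :=
  if h : v ∈ Doubled X s E then .copy b v h else .keep v h

open Classical in
/-- The reduct `F', s₁ ⋈ t^L, s₂ ⋈ t^R`, where `S₁` is the set of witnesses in `s₁`.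

* The witnesses of `s` in `S₁` are put in the left copy of `s`, the others in the right copy;
  the left copy of `s` is cut against `t^L` and the right copy against `t^R`.
* A witness of the subnet that is a successor of an expansion outside it is replaced by its two
  copies, both successors of that expansion.
* A witness `w` of the subnet that is a root is replaced by the root `(w^L + w^R)`.
* A cut of the subnet is replaced by its two copies. -/
noncomputable def contrReduct : LabelledForest P W (ContrNode G X s E) where
  pr
    | .keep v _ => (G.pr v).map (contrPlace G X s E (if v ∈ S₁ then .L else .R))
    | .copy b v _ =>
      match G.pr v with
      | some u => some (contrPlace G X s E b u)
      | none => if h : v ∈ RootWitness G E then some (.sum v h) else none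
    | .sum _ _ => none
  label
    | .keep v _ => G.label v
    | .copy b v _ => (G.label v).rename (ρ b)
    | .sum _ _ => .plus
  idx
    | .keep v _ => G.idx v
    | .copy _ v _ => G.idx v
    | .sum _ _ => 0
  ty
    | .keep v _ => G.ty v
    | .copy _ v _ => G.ty v
    | .sum w _ => (G.ty w).map fun τ => .formula τ.underlying

end Contraction

end ExpansionNet

/-!
The combinatorial core is that the reduct is AC; the typing conditions are checked node by node.

The nodes of the reduct form two *layers*, the kept nodes together with the left copies, and the
kept nodes together with the right copies; besides these there are only the new expansions
`(w^L + w^R)`. A switching of the reduct induces, through each layer, a switching of the original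
forest (`layerSwitching`), and the layer is then a subgraph of the induced switching graph
(`adj_of_contrPlace`). Hence no cycle of the reduct stays in one layer, and it remains to see that
no cycle runs along an edge between the copies on one side and the other nodes. By `adj_copy`
there are two sorts of such edges.

* The copy of a root `w` of `E` is joined to the expansion that has it as a summand. Consider the
  kept nodes that are joined to this expansion by kept nodes. If a second edge led from this set
  to a copy, there would be in the original forest a switching path outside `E` from `w` to
  another root of `E`; where the edge leads to a copy of `s`, this path continues through the cut
  to `t`. As `E` is a subnet, there is no such path. So the edge is the only one that leaves the
  set, and a cycle, which crosses every cut an even number of times, avoids it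
  (`notMem_edges_of_pr_copy`).
* The copy of `s` is joined to the witness that the switching chooses. All other edges that leave
  the copies on the same side are of the first sort, so that a cycle would have to cross the
  boundary of these copies just once (`copy_copy_of_mem_edges`).

The same switching path through `s` and the cut shows that no witness of `s` lies in `E`
(`notMem_doubled_of_pr_s`), so that the split of `s` is not affected by the duplication.
-/

namespace ExpansionNet

/-! ### Cycles and cuts in simple graphs -/

/-- A cycle that crosses the cut `(S, Sᶜ)` along an edge crosses it along another edge as well. -/
theorem exists_crossing_edge_ne {V : Type*} {H : SimpleGraph V} {v : V} {c : H.Walk v v}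
    (hc : c.IsCycle) (S : Set V) {a b : V} (ha : a ∈ S) (hb : b ∉ S) (hab : s(a, b) ∈ c.edges) :
    ∃ a' ∈ S, ∃ b' ∉ S, s(a', b') ∈ c.edges ∧ s(a', b') ≠ s(a, b) := by
  by_contra! hcon
  let K : SimpleGraph V := SimpleGraph.fromEdgeSet {e | e ∈ c.edges}
  have hK : ∀ e ∈ c.edges, e ∈ K.edgeSet := fun e he ↦ by
    rw [SimpleGraph.edgeSet_fromEdgeSet]
    exact ⟨he, fun h ↦ H.not_isDiag_of_mem_edgeSet (c.edges_subset_edgeSet he) h⟩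
  have hreach := (SimpleGraph.adj_and_reachable_delete_edges_iff_exists_cycle.mpr
    ⟨v, c.transfer K hK, hc.transfer hK, by rwa [SimpleGraph.Walk.edges_transfer]⟩).2
  obtain ⟨p⟩ := hreach
  have key : ∀ {x y : V} (_ : (K \ SimpleGraph.fromEdgeSet {s(a, b)}).Walk x y),
      x ∈ S → y ∈ S := by
    intro x y q
    induction q with
    | nil => exact id
    | cons h _ ih =>
      intro hx
      refine ih (by_contra fun hy ↦ ?_)
      rw [SimpleGraph.sdiff_adj, SimpleGraph.fromEdgeSet_adj, SimpleGraph.fromEdgeSet_adj] at h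
      exact h.2 ⟨hcon _ hx _ hy h.1.1, h.1.2⟩
  exact hb (key p ha)

/-- A walk that starts in `S` and does not cross the cut `(S, Sᶜ)` stays in `S`. -/
theorem support_subset_of_forall_not_crossing {V : Type*} {H : SimpleGraph V} {S : Set V}
    {u v : V} (c : H.Walk u v) (hu : u ∈ S) (hc : ∀ a ∈ S, ∀ b ∉ S, s(a, b) ∉ c.edges) :
    ∀ z ∈ c.support, z ∈ S := by
  induction c with
  | nil => simpa using hu
  | @cons x y z h q ih =>
    have hy : y ∈ S := by_contra fun hy ↦ hc _ hu _ hy (by simp)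
    have := ih hy fun a ha b hb hab ↦ hc a ha b hb (by simp [hab])
    simpa [hu] using this

/-- If `f` pulls `H` back to a subgraph of an acyclic graph, then no cycle of `H`
lies in the range of `f`. -/
theorem not_isCycle_of_support_subset_range {V U : Type*} {H : SimpleGraph V} {K : SimpleGraph U}
    (hK : K.IsAcyclic) {f : U → V}
    (hadj : ∀ a b, H.Adj (f a) (f b) → K.Adj a b) {v : V} (c : H.Walk v v)
    (hc : ∀ z ∈ c.support, z ∈ Set.range f) : ¬ c.IsCycle := by
  intro hcyc
  have hcy : (c.induce (Set.range f) hc).IsCycle := by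
    rw [← SimpleGraph.Walk.isCycle_map_iff_of_injective
      (f := (SimpleGraph.Embedding.induce (G := H) (Set.range f)).toHom)
      (SimpleGraph.Embedding.induce (G := H) (Set.range f)).injective]
    rwa [SimpleGraph.Walk.map_induce]
  choose g hg using fun z : Set.range f ↦ z.2
  let φ : H.induce (Set.range f) →g K :=
    ⟨g, fun {a b} h ↦ hadj _ _ (by rw [hg, hg]; exact h)⟩
  have hφ : Function.Injective φ := fun a b h ↦ by
    have h' : g a = g b := h
    exact Subtype.ext (by rw [← hg a, ← hg b, h'])
  exact SimpleGraph.IsAcyclic.comap φ hφ hK _ hcy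

namespace LabelledForest

variable {P W V : Type*} {F : LabelledForest P W V}

/-! ### Typed forests and subnets -/

theorem switchingGraph_adj {σ : V → V} {a b : V} :
    (F.switchingGraph σ).Adj a b ↔ a ≠ b ∧ (F.SwitchEdge σ a b ∨ F.SwitchEdge σ b a) :=
  SimpleGraph.fromRel_adj _ _ _

theorem IsForest.pr_ne_self (hF : F.IsForest) (v : V) : F.pr v ≠ some v := by
  intro hv
  obtain ⟨r, hr, hroot⟩ := hF v
  have : ∀ r, Relation.ReflTransGen (fun a b => F.pr a = some b) v r → r = v := by
    intro r hr
    induction hr with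
    | refl => rfl
    | tail _ h ih => subst ih; exact Option.some.inj (h.symm.trans hv)
  rw [this r hr] at hroot
  exact Option.some_ne_none _ (hv.symm.trans hroot)

/-- An edge from a node to its predecessor is in the switching graph if it is kept. -/
theorem IsForest.switchingGraph_adj_of_pr (hF : F.IsForest) {σ : V → V} {a b : V}
    (h : F.pr a = some b) (hσ : F.Switched b → σ b = a) : (F.switchingGraph σ).Adj a b :=
  switchingGraph_adj.2 ⟨fun hab ↦ hF.pr_ne_self b (hab ▸ h), Or.inl (Or.inl ⟨h, hσ⟩)⟩

/-- Two different roots of a subnet are not joined by a switching path outside it. -/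
theorem IsSubnet.not_walk_outside {E : Set V} (hE : F.IsSubnet E) {σ : V → V}
    (hσ : F.IsSwitching σ) {x y a b : V} (hx : F.IsRootOf E x) (hy : F.IsRootOf E y)
    (hxy : x ≠ y) (hxa : (F.switchingGraph σ).Adj x a) (hby : (F.switchingGraph σ).Adj b y)
    (q : (F.switchingGraph σ).Walk a b) (hq : ∀ z ∈ q.support, z ∉ E) : False := by
  classical
  have hsub : ∀ z ∈ q.bypass.support, z ∉ E := fun z hz ↦
    hq z (q.support_bypass_subset_support hz)
  have hxq : x ∉ q.bypass.support := fun h ↦ hsub _ h hx.1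
  have hyq : y ∉ q.bypass.support := fun h ↦ hsub _ h hy.1
  have hp : (SimpleGraph.Walk.cons hxa (q.bypass.concat hby)).IsPath := by
    rw [SimpleGraph.Walk.cons_isPath_iff]
    refine ⟨q.bypass_isPath.concat hyq hby, ?_⟩
    rw [SimpleGraph.Walk.support_concat]
    simp [hxq, hxy]
  refine hq a q.start_mem_support (hE.2 σ hσ x y hx hy _ hp a ?_)
  simp [SimpleGraph.Walk.support_concat]

/-- A node whose label is that of a witness has a witness type. -/
theorem WellTypedAt.exists_isWitness {v : V} (h : F.WellTypedAt v) (hv : (F.label v).IsWitness) :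
    ∃ τ, F.ty v = some τ ∧ τ.IsWitness := by
  cases h <;> simp_all [Label.IsWitness, Ty.IsWitness]

/-- The predecessor of a witness is an expansion. -/
theorem IsTypedForest.label_pr_eq_plus (hF : F.IsTypedForest) {v u : V}
    (hv : (F.label v).IsWitness) (hvu : F.pr v = some u) : F.label u = .plus := by
  obtain ⟨τ, hτ, hw⟩ := (hF.wellTyped v).exists_isWitness hv
  have hmem : v ∈ F.succs u := hvu
  have hform : ∀ A, F.ty v ≠ some (.formula A) := by
    rintro A hA
    rw [hτ, Option.some.injEq] at hA
    simp [hA, Ty.IsWitness] at hw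
  have hstar : F.label v ≠ .star := fun h ↦ by simp [h, Label.IsWitness] at hv
  cases hF.wellTyped u with
  | one _ h => simp [h] at hmem
  | pos _ _ _ h => simp [h] at hmem
  | neg _ _ _ h => simp [h] at hmem
  | tensor l r A B _ h hl hr =>
    rw [h.1] at hmem
    rcases hmem with rfl | rfl
    exacts [(hform _ hl).elim, (hform _ hr).elim]
  | plus _ h => exact h
  | or l r A B _ h hl hr =>
    rw [h.1] at hmem
    rcases hmem with rfl | rfl
    exacts [(hform _ hl).elim, (hform _ hr).elim]
  | orStar l r A B _ h hl hr =>
    rw [h.1] at hmem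
    rcases hmem with rfl | rfl
    exacts [(hform _ hl).elim, (hstar hr).elim]
  | starOr l r A B _ h hl hr =>
    rw [h.1] at hmem
    rcases hmem with rfl | rfl
    exacts [(hstar hl).elim, (hform _ hr).elim]
  | star _ h => simp [h] at hmem
  | cut l r A _ _ _ h hl hr =>
    rw [h] at hmem
    rcases hmem with rfl | rfl
    exacts [(hform _ hl).elim, (hform _ hr).elim]

theorem IsTypedForest.isRoot_of_cut (hF : F.IsTypedForest) {v : V} (hv : F.label v = .cut) :
    F.IsRoot v := by
  cases hF.wellTyped v <;> simp_all

/-- The successors of a cut are any two different successors of it. -/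
theorem IsTypedForest.succs_cut (hF : F.IsTypedForest) {v a b : V} (hv : F.label v = .cut)
    (hab : a ≠ b) (ha : F.pr a = some v) (hb : F.pr b = some v) : F.succs v = {a, b} := by
  have ha' : a ∈ F.succs v := ha
  have hb' : b ∈ F.succs v := hb
  cases hF.wellTyped v with
  | cut l r A _ _ _ h =>
    rw [h] at ha' hb' ⊢
    rcases ha' with rfl | rfl <;> rcases hb' with rfl | rfl
    exacts [(hab rfl).elim, rfl, Set.pair_comm _ _, (hab rfl).elim]
  | _ => simp_all

end LabelledForest

/-! ### Contractible cuts -/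

/-- The hypotheses of a contraction step: `X` is a cut `s ⋈ t` of a typed AC forest, `s` is an
expansion with a proper nonempty set `S₁` of its witnesses, and `E` is a subnet with root `t`
whose other roots are witnesses or cuts. -/
structure IsContractible {P W V : Type*} (G : LabelledForest P W V) (X s t : V) (S₁ E : Set V) :
    Prop where
  typed : G.IsTypedForest
  ac : G.AC
  label_X : G.label X = .cut
  label_s : G.label s = .plus
  ne : s ≠ t
  pr_s : G.pr s = some X
  pr_t : G.pr t = some X
  left_nonempty : ∃ a ∈ S₁, G.pr a = some s
  right_nonempty : ∃ a ∉ S₁, G.pr a = some s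
  subnet : G.IsSubnet E
  root_t : G.IsRootOf E t
  roots : ∀ r, G.IsRootOf E r → r ≠ t → (G.label r).IsWitness ∨ G.label r = .cut

namespace IsContractible

variable {P W V : Type*} {G : LabelledForest P W V} {X s t : V} {S₁ E : Set V}

theorem X_notMem (h : IsContractible G X s t S₁ E) : X ∉ E :=
  fun hX ↦ h.root_t.2 X hX h.pr_t

theorem s_notMem (h : IsContractible G X s t S₁ E) : s ∉ E := by
  intro hs
  have hroot : G.IsRootOf E s := ⟨hs, fun u hu hsu ↦ by
    rw [h.pr_s, Option.some.injEq] at hsu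
    exact h.X_notMem (hsu ▸ hu)⟩
  rcases h.roots s hroot h.ne with hl | hl <;> simp [h.label_s, Label.IsWitness] at hl

theorem pr_X (h : IsContractible G X s t S₁ E) : G.pr X = none :=
  h.typed.isRoot_of_cut h.label_X

theorem succs_X (h : IsContractible G X s t S₁ E) : G.succs X = {s, t} :=
  h.typed.succs_cut h.label_X h.ne h.pr_s h.pr_t

theorem not_switched_X (h : IsContractible G X s t S₁ E) : ¬ G.Switched X := by
  simp [LabelledForest.Switched, h.label_X]

theorem switched_s (h : IsContractible G X s t S₁ E) : G.Switched s := Or.inl h.label_s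

/-- The doubled part is closed under successors, except at the expansion that is split. -/
theorem mem_doubled_of_pr (h : IsContractible G X s t S₁ E) {a v : V} (ha : G.pr a = some v)
    (hv : v ∈ Doubled X s E) (hvs : v ≠ s) : a ∈ Doubled X s E := by
  rcases hv with hv | rfl | rfl
  · exact Or.inl (h.subnet.1.upward a v ha hv)
  · have : a ∈ G.succs v := ha
    rw [h.succs_X] at this
    rcases this with rfl | rfl
    exacts [Or.inr (Or.inr rfl), Or.inl h.root_t.1]
  · exact (hvs rfl).elim

/-- No witness of `s` is doubled: a witness of `s` in `E` would be joined to the root `t` of `E`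
by the switching path through `s` and the cut. -/
theorem notMem_doubled_of_pr_s (h : IsContractible G X s t S₁ E) {a : V} (ha : G.pr a = some s) :
    a ∉ Doubled X s E := by
  classical
  rintro (haE | rfl | rfl)
  · have hroot : G.IsRootOf E a := ⟨haE, fun u hu hau ↦ by
      rw [ha, Option.some.injEq] at hau
      exact h.s_notMem (hau ▸ hu)⟩
    have hat : a ≠ t := by
      rintro rfl
      have := ha.symm.trans h.pr_t
      rw [Option.some.injEq] at this
      subst this
      exact h.typed.forest.pr_ne_self _ h.pr_s
    have hne : ∀ v, G.Switched v → (G.succs v).Nonempty := by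
      rintro v (hv | ⟨hv, -⟩)
      · cases h.typed.wellTyped v <;> simp_all
      · cases h.typed.wellTyped v <;>
          simp_all [LabelledForest.Binary]
    let σ : V → V := fun v ↦
      if v = s then a else if hv : (G.succs v).Nonempty then hv.some else v
    have hσ : G.IsSwitching σ := by
      intro v hv
      by_cases hvs : v = s
      · subst hvs; simpa [σ, LabelledForest.succs] using ha
      · simp only [σ, hvs, if_false, hne v hv, dif_pos]
        exact (hne v hv).some_mem
    have h1 := h.typed.forest.switchingGraph_adj_of_pr (σ := σ) ha (fun _ ↦ by simp [σ])
    have h2 := h.typed.forest.switchingGraph_adj_of_pr (σ := σ) h.pr_s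
      (fun hX ↦ (h.not_switched_X hX).elim)
    have h3 := h.typed.forest.switchingGraph_adj_of_pr (σ := σ) h.pr_t
      (fun hX ↦ (h.not_switched_X hX).elim)
    refine h.subnet.not_walk_outside hσ hroot h.root_t hat h1 h3.symm (.cons h2 .nil) ?_
    simp [h.s_notMem, h.X_notMem]
  · simp [h.pr_X] at ha
  · exact h.typed.forest.pr_ne_self _ ha

/-- A doubled node whose predecessor is not doubled is a root of `E` other than `t`, and is a
witness in an expansion. -/
theorem of_pr_notMem_doubled (h : IsContractible G X s t S₁ E) {a v : V} (ha : G.pr a = some v)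
    (haD : a ∈ Doubled X s E) (hv : v ∉ Doubled X s E) :
    G.IsRootOf E a ∧ a ≠ t ∧ G.label v = .plus := by
  have hX : X ∈ Doubled X s E := Or.inr (Or.inl rfl)
  rcases haD with haE | rfl | rfl
  · have hroot : G.IsRootOf E a := ⟨haE, fun u hu hau ↦ by
      rw [ha, Option.some.injEq] at hau
      exact hv (hau ▸ Or.inl hu)⟩
    have hat : a ≠ t := by
      rintro rfl
      rw [h.pr_t, Option.some.injEq] at ha
      exact hv (ha ▸ hX)
    refine ⟨hroot, hat, ?_⟩
    rcases h.roots a hroot hat with hw | hc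
    · exact h.typed.label_pr_eq_plus hw ha
    · have := h.typed.isRoot_of_cut hc
      rw [LabelledForest.IsRoot, ha] at this
      cases this
  · simp [h.pr_X] at ha
  · rw [h.pr_s, Option.some.injEq] at ha
    exact (hv (ha ▸ hX)).elim

/-- A doubled node that is a root is a cut or a root witness. -/
theorem of_pr_none (h : IsContractible G X s t S₁ E) {a : V} (ha : G.pr a = none)
    (haD : a ∈ Doubled X s E) : G.label a = .cut ∨ a ∈ RootWitness G E := by
  rcases haD with haE | rfl | rfl
  · have hat : a ≠ t := by
      rintro rfl
      simp [h.pr_t] at ha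
    rcases h.roots a ⟨haE, by simp [ha]⟩ hat with hw | hc
    exacts [Or.inr ⟨haE, ha, hw⟩, Or.inl hc]
  · exact Or.inl h.label_X
  · simp [h.pr_s] at ha

theorem mem_of_label_pos (h : IsContractible G X s t S₁ E) {v : V} {x : W}
    (hv : v ∈ Doubled X s E) (hl : G.label v = .pos x) : v ∈ E := by
  rcases hv with hv | rfl | rfl
  exacts [hv, by simp [h.label_X] at hl, by simp [h.label_s] at hl]

theorem mem_of_label_neg (h : IsContractible G X s t S₁ E) {v : V} {x : W}
    (hv : v ∈ Doubled X s E) (hl : G.label v = .neg x) : v ∈ E := by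
  rcases hv with hv | rfl | rfl
  exacts [hv, by simp [h.label_X] at hl, by simp [h.label_s] at hl]

/-- Axiom links do not leave the doubled part. -/
theorem mem_doubled_iff_of_link (h : IsContractible G X s t S₁ E) {u v : V} {x : W}
    (hu : G.label u = .pos x) (hv : G.label v = .neg x) :
    u ∈ Doubled X s E ↔ v ∈ Doubled X s E :=
  ⟨fun hD ↦ Or.inl ((h.subnet.1.links u v x hu hv).1 (h.mem_of_label_pos hD hu)),
    fun hD ↦ Or.inl ((h.subnet.1.links u v x hu hv).2 (h.mem_of_label_neg hD hv))⟩

end IsContractible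

/-! ### Nodes of the reduct -/

namespace Label

variable {W : Type*} {ρ : W → W} {l : Label W}

theorem rename_id (l : Label W) : l.rename id = l := by cases l <;> rfl

@[simp] theorem rename_eq_one : l.rename ρ = .one ↔ l = .one := by cases l <;> simp [rename]
@[simp] theorem rename_eq_star : l.rename ρ = .star ↔ l = .star := by cases l <;> simp [rename]
@[simp] theorem rename_eq_plus : l.rename ρ = .plus ↔ l = .plus := by cases l <;> simp [rename]
@[simp] theorem rename_eq_or : l.rename ρ = .or ↔ l = .or := by cases l <;> simp [rename]
@[simp] theorem rename_eq_tensor : l.rename ρ = .tensor ↔ l = .tensor := by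
  cases l <;> simp [rename]
@[simp] theorem rename_eq_cut : l.rename ρ = .cut ↔ l = .cut := by cases l <;> simp [rename]
theorem rename_eq_pos {x : W} : l.rename ρ = .pos x ↔ ∃ y, l = .pos y ∧ ρ y = x := by
  cases l <;> simp [rename]
theorem rename_eq_neg {x : W} : l.rename ρ = .neg x ↔ ∃ y, l = .neg y ∧ ρ y = x := by
  cases l <;> simp [rename]

end Label

section

variable {P W V : Type*} {G : LabelledForest P W V} {X s t : V} {S₁ E : Set V}
  {ρ : Side → W → W}

/-- The node of the original forest that a node of the reduct comes from; a new expansion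
`(w^L + w^R)` is sent to `w`. -/
def ContrNode.origin : ContrNode G X s E → V
  | .keep v _ => v
  | .copy _ v _ => v
  | .sum w _ => w

theorem contrPlace_of_mem {b : Side} {v : V} (h : v ∈ Doubled X s E) :
    contrPlace G X s E b v = .copy b v h := dif_pos h

theorem contrPlace_of_notMem {b : Side} {v : V} (h : v ∉ Doubled X s E) :
    contrPlace G X s E b v = .keep v h := dif_neg h

@[simp] theorem origin_contrPlace (b : Side) (v : V) : (contrPlace G X s E b v).origin = v := by
  by_cases h : v ∈ Doubled X s E
  · rw [contrPlace_of_mem h]; rfl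
  · rw [contrPlace_of_notMem h]; rfl

theorem contrPlace_injective (b : Side) : Function.Injective (contrPlace G X s E b) :=
  Function.LeftInverse.injective (origin_contrPlace b)

theorem contrPlace_ne_sum (b : Side) (v w : V) (hw : w ∈ RootWitness G E) :
    contrPlace G X s E b v ≠ .sum w hw := by
  by_cases h : v ∈ Doubled X s E
  · rw [contrPlace_of_mem h]; nofun
  · rw [contrPlace_of_notMem h]; nofun

open Classical in
/-- The side of the reduct on which the expansion `s` keeps its witness `v`. -/
noncomputable def sideOf (S₁ : Set V) (v : V) : Side := if v ∈ S₁ then .L else .R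

theorem pr_keep {v : V} (h : v ∉ Doubled X s E) :
    (contrReduct G X s S₁ E ρ).pr (.keep v h) =
      (G.pr v).map (contrPlace G X s E (sideOf S₁ v)) := rfl

theorem pr_copy {b : Side} {v u : V} (h : v ∈ Doubled X s E) (hu : G.pr v = some u) :
    (contrReduct G X s S₁ E ρ).pr (.copy b v h) = some (contrPlace G X s E b u) := by
  simp [contrReduct, hu]

theorem pr_copy_rootWitness {b : Side} {v : V} (h : v ∈ Doubled X s E)
    (hv : v ∈ RootWitness G E) :
    (contrReduct G X s S₁ E ρ).pr (.copy b v h) = some (.sum v hv) := by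
  have : G.pr v = none := hv.2.1
  simp only [contrReduct, this]
  exact dif_pos hv

theorem pr_copy_eq_none {b : Side} {v : V} (h : v ∈ Doubled X s E) (hp : G.pr v = none)
    (hv : v ∉ RootWitness G E) :
    (contrReduct G X s S₁ E ρ).pr (.copy b v h) = none := by
  simp only [contrReduct, hp]
  exact dif_neg hv

theorem pr_sum {w : V} (h : w ∈ RootWitness G E) :
    (contrReduct G X s S₁ E ρ).pr (.sum w h) = none := rfl

theorem label_copy {b : Side} {v : V} (h : v ∈ Doubled X s E) :
    (contrReduct G X s S₁ E ρ).label (.copy b v h) = (G.label v).rename (ρ b) := rfl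

theorem label_sum {w : V} (h : w ∈ RootWitness G E) :
    (contrReduct G X s S₁ E ρ).label (.sum w h) = .plus := rfl

theorem exists_label_contrPlace (b : Side) (v : V) :
    ∃ f, (contrReduct G X s S₁ E ρ).label (contrPlace G X s E b v) = (G.label v).rename f := by
  by_cases h : v ∈ Doubled X s E
  · exact ⟨ρ b, by rw [contrPlace_of_mem h]; rfl⟩
  · exact ⟨id, by rw [contrPlace_of_notMem h, Label.rename_id]; rfl⟩

@[simp] theorem ty_contrPlace (b : Side) (v : V) :
    (contrReduct G X s S₁ E ρ).ty (contrPlace G X s E b v) = G.ty v := by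
  by_cases h : v ∈ Doubled X s E
  · rw [contrPlace_of_mem h]; rfl
  · rw [contrPlace_of_notMem h]; rfl

@[simp] theorem idx_contrPlace (b : Side) (v : V) :
    (contrReduct G X s S₁ E ρ).idx (contrPlace G X s E b v) = G.idx v := by
  by_cases h : v ∈ Doubled X s E
  · rw [contrPlace_of_mem h]; rfl
  · rw [contrPlace_of_notMem h]; rfl

theorem exists_pr_contrPlace {v u : V} (b : Side) (hv : G.pr v = some u) :
    ∃ c, (contrReduct G X s S₁ E ρ).pr (contrPlace G X s E b v) =
      some (contrPlace G X s E c u) := by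
  by_cases h : v ∈ Doubled X s E
  · exact ⟨b, by rw [contrPlace_of_mem h, pr_copy h hv]⟩
  · exact ⟨sideOf S₁ v, by rw [contrPlace_of_notMem h, pr_keep h, hv]; rfl⟩

/-- A successor of `contrPlace b v` is not a new expansion, and comes from a successor of `v`. -/
theorem eq_contrPlace_of_pr {y : ContrNode G X s E} {b : Side} {v : V}
    (hy : (contrReduct G X s S₁ E ρ).pr y = some (contrPlace G X s E b v)) :
    G.pr y.origin = some v ∧ ∃ c, y = contrPlace G X s E c y.origin := by
  rcases y with ⟨a, ha⟩ | ⟨c, a, ha⟩ | ⟨w, hw⟩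
  · refine ⟨?_, .L, (contrPlace_of_notMem ha).symm⟩
    rw [pr_keep, Option.map_eq_some_iff] at hy
    obtain ⟨u, hu, huv⟩ := hy
    have := congrArg ContrNode.origin huv
    rw [origin_contrPlace, origin_contrPlace] at this
    exact this ▸ hu
  · refine ⟨?_, c, (contrPlace_of_mem ha).symm⟩
    rcases hp : G.pr a with _ | u
    · by_cases hw : a ∈ RootWitness G E
      · rw [pr_copy_rootWitness ha hw, Option.some.injEq] at hy
        exact (contrPlace_ne_sum _ _ _ _ hy.symm).elim
      · simp [pr_copy_eq_none ha hp hw] at hy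
    · rw [pr_copy ha hp, Option.some.injEq] at hy
      have := congrArg ContrNode.origin hy
      rw [origin_contrPlace, origin_contrPlace] at this
      exact this ▸ hp
  · simp [pr_sum] at hy

/-- The successors of a new expansion `(w^L + w^R)` are the two copies of `w`. -/
theorem eq_copy_of_pr_sum {y : ContrNode G X s E} {w : V} {hw : w ∈ RootWitness G E}
    (hy : (contrReduct G X s S₁ E ρ).pr y = some (.sum w hw)) :
    ∃ b, y = .copy b w (Or.inl hw.1) := by
  rcases y with ⟨a, ha⟩ | ⟨c, a, ha⟩ | ⟨w, hw⟩
  · rw [pr_keep, Option.map_eq_some_iff] at hy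
    obtain ⟨u, -, huv⟩ := hy
    exact (contrPlace_ne_sum _ _ _ _ huv).elim
  · rcases hp : G.pr a with _ | u
    · by_cases hw : a ∈ RootWitness G E
      · rw [pr_copy_rootWitness ha hw, Option.some.injEq, ContrNode.sum.injEq] at hy
        subst hy
        exact ⟨c, rfl⟩
      · simp [pr_copy_eq_none ha hp hw] at hy
    · rw [pr_copy ha hp, Option.some.injEq] at hy
      exact (contrPlace_ne_sum _ _ _ _ hy).elim
  · simp [pr_sum] at hy

theorem pr_keep_of_pr_s (h : IsContractible G X s t S₁ E) {a : V} (ha : G.pr a = some s) :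
    (contrReduct G X s S₁ E ρ).pr (.keep a (h.notMem_doubled_of_pr_s ha)) =
      some (.copy (sideOf S₁ a) s (Or.inr (Or.inr rfl))) := by
  rw [pr_keep, ha, Option.map_some, contrPlace_of_mem (Or.inr (Or.inr rfl))]

/-- Away from the expansion that is split, each of the two layers of the reduct has the
predecessors of the original forest. -/
theorem pr_contrPlace (h : IsContractible G X s t S₁ E) (b : Side) {a v : V}
    (ha : G.pr a = some v) (hv : v ≠ s) :
    (contrReduct G X s S₁ E ρ).pr (contrPlace G X s E b a) = some (contrPlace G X s E b v) := by
  by_cases haD : a ∈ Doubled X s E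
  · rw [contrPlace_of_mem haD, pr_copy haD ha]
  · have hvD : v ∉ Doubled X s E := fun hvD ↦ haD (h.mem_doubled_of_pr ha hvD hv)
    rw [contrPlace_of_notMem haD, pr_keep, ha, Option.map_some, contrPlace_of_notMem hvD,
      contrPlace_of_notMem hvD]

theorem succs_contrPlace (h : IsContractible G X s t S₁ E) (b : Side) {v : V}
    (hv : G.label v ≠ .plus) :
    (contrReduct G X s S₁ E ρ).succs (contrPlace G X s E b v) =
      contrPlace G X s E b '' G.succs v := by
  ext y
  constructor
  · intro hy
    obtain ⟨hp, c, hc⟩ := eq_contrPlace_of_pr hy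
    refine ⟨y.origin, hp, ?_⟩
    by_cases haD : y.origin ∈ Doubled X s E
    · have hvD : v ∈ Doubled X s E := by
        by_contra hvD
        exact hv (h.of_pr_notMem_doubled hp haD hvD).2.2
      have hy' : (contrReduct G X s S₁ E ρ).pr y = some (contrPlace G X s E b v) := hy
      rw [hc, contrPlace_of_mem haD, pr_copy haD hp, contrPlace_of_mem hvD,
        contrPlace_of_mem hvD] at hy'
      obtain rfl : c = b := by simpa using hy'
      exact hc.symm
    · rw [hc, origin_contrPlace, contrPlace_of_notMem haD, contrPlace_of_notMem haD]
  · rintro ⟨a, ha, rfl⟩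
    exact pr_contrPlace h b ha fun hvs ↦ hv (hvs ▸ h.label_s)

theorem binary_contrPlace (h : IsContractible G X s t S₁ E) (b : Side) {v l r : V}
    (hv : G.label v ≠ .plus) (hlr : G.Binary v l r) :
    (contrReduct G X s S₁ E ρ).Binary (contrPlace G X s E b v) (contrPlace G X s E b l)
      (contrPlace G X s E b r) := by
  refine ⟨?_, by simpa using hlr.2.1, by simpa using hlr.2.2⟩
  rw [succs_contrPlace h b hv, hlr.1, Set.image_pair]

/-- An expansion keeps at least one witness in each layer of the reduct. -/
theorem succs_contrPlace_nonempty (h : IsContractible G X s t S₁ E) (b : Side) {v : V}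
    (hv : (G.succs v).Nonempty) :
    ((contrReduct G X s S₁ E ρ).succs (contrPlace G X s E b v)).Nonempty := by
  by_cases hvs : v = s
  · subst hvs
    have hex : ∃ a, G.pr a = some v ∧ sideOf S₁ a = b := by
      cases b with
      | L => obtain ⟨a, ha, hp⟩ := h.left_nonempty; exact ⟨a, hp, by simp [sideOf, ha]⟩
      | R => obtain ⟨a, ha, hp⟩ := h.right_nonempty; exact ⟨a, hp, by simp [sideOf, ha]⟩
    obtain ⟨a, ha, rfl⟩ := hex
    refine ⟨.keep a (h.notMem_doubled_of_pr_s ha), ?_⟩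
    rw [contrPlace_of_mem (Or.inr (Or.inr rfl))]
    exact pr_keep_of_pr_s h ha
  · obtain ⟨a, ha⟩ := hv
    exact ⟨_, pr_contrPlace h b ha hvs⟩

/-! ### The reduct is a typed forest -/

theorem finite_contrNode [Finite V] : Finite (ContrNode G X s E) := by
  have : Finite Side := Finite.of_injective (β := Bool)
    (fun | .L => true | .R => false) (by intro a b; cases a <;> cases b <;> simp)
  let f : ContrNode G X s E → V ⊕ (Side × V) ⊕ V
    | .keep v _ => .inl v
    | .copy b v _ => .inr (.inl (b, v))
    | .sum w _ => .inr (.inr w)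
  refine Finite.of_injective f ?_
  rintro (_ | _ | _) (_ | _ | _) <;> simp [f]

theorem isForest_contrReduct (h : IsContractible G X s t S₁ E) :
    (contrReduct G X s S₁ E ρ).IsForest := by
  have key : ∀ v, ∀ b, ∃ r, Relation.ReflTransGen
      (fun a b => (contrReduct G X s S₁ E ρ).pr a = some b) (contrPlace G X s E b v) r ∧
        (contrReduct G X s S₁ E ρ).IsRoot r := by
    intro v
    obtain ⟨r, hr, hroot⟩ := h.typed.forest v
    induction hr using Relation.ReflTransGen.head_induction_on with
    | refl =>
      intro b
      by_cases hD : r ∈ Doubled X s E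
      · rw [contrPlace_of_mem hD]
        by_cases hw : r ∈ RootWitness G E
        · exact ⟨_, .single (pr_copy_rootWitness hD hw), pr_sum hw⟩
        · exact ⟨_, .refl, pr_copy_eq_none hD hroot hw⟩
      · refine ⟨_, .refl, ?_⟩
        rw [contrPlace_of_notMem hD, LabelledForest.IsRoot, pr_keep,
          show G.pr r = none from hroot, Option.map_none]
    | head hab _ ih =>
      intro b
      obtain ⟨c, hc⟩ := exists_pr_contrPlace (S₁ := S₁) (ρ := ρ) b hab
      obtain ⟨r', hr', hroot'⟩ := ih c
      exact ⟨r', .head hc hr', hroot'⟩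
  rintro (⟨v, hv⟩ | ⟨b, v, hv⟩ | ⟨w, hw⟩)
  · simpa only [contrPlace_of_notMem hv] using key v .L
  · simpa only [contrPlace_of_mem hv] using key v b
  · exact ⟨_, .refl, pr_sum hw⟩

theorem wellTypedAt_contrPlace (h : IsContractible G X s t S₁ E) (b : Side) (v : V) :
    (contrReduct G X s S₁ E ρ).WellTypedAt (contrPlace G X s E b v) := by
  obtain ⟨f, hf⟩ := exists_label_contrPlace (S₁ := S₁) (ρ := ρ) (G := G) (X := X) (s := s)
    (E := E) b v
  have hstar : ∀ u, G.label u = .star →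
      (contrReduct G X s S₁ E ρ).label (contrPlace G X s E b u) = .star := by
    intro u hu
    obtain ⟨f, hf⟩ := exists_label_contrPlace (S₁ := S₁) (ρ := ρ) (G := G) (X := X) (s := s)
      (E := E) b u
    rw [hf, hu]; rfl
  have hempty : G.label v ≠ .plus → G.succs v = ∅ →
      (contrReduct G X s S₁ E ρ).succs (contrPlace G X s E b v) = ∅ := by
    intro hv hs
    rw [succs_contrPlace h b hv, hs, Set.image_empty]
  cases h.typed.wellTyped v with
  | one hl hs ht => exact .one (by simp [hf, hl]) (hempty (by simp [hl]) hs) (by simpa using ht)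
  | pos x p hl hs ht =>
    exact .pos (f x) p (by simp [hf, hl, Label.rename]) (hempty (by simp [hl]) hs)
      (by simpa using ht)
  | neg x p hl hs ht =>
    exact .neg (f x) p (by simp [hf, hl, Label.rename]) (hempty (by simp [hl]) hs)
      (by simpa using ht)
  | tensor l r A B hl hB h1 h2 ht =>
    exact .tensor _ _ A B (by simp [hf, hl]) (binary_contrPlace h b (by simp [hl]) hB)
      (by simpa using h1) (by simpa using h2) (by simpa using ht)
  | plus τ hl hs hw hu ht =>
    refine .plus τ (by simp [hf, hl]) (succs_contrPlace_nonempty h b hs) hw ?_ (by simpa using ht)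
    intro y hy
    obtain ⟨hp, c, hc⟩ := eq_contrPlace_of_pr hy
    rw [hc, ty_contrPlace]
    exact hu _ hp
  | or l r A B hl hB h1 h2 ht =>
    exact .or _ _ A B (by simp [hf, hl]) (binary_contrPlace h b (by simp [hl]) hB)
      (by simpa using h1) (by simpa using h2) (by simpa using ht)
  | orStar l r A B hl hB h1 h2 ht =>
    exact .orStar _ _ A B (by simp [hf, hl]) (binary_contrPlace h b (by simp [hl]) hB)
      (by simpa using h1) (hstar r h2) (by simpa using ht)
  | starOr l r A B hl hB h1 h2 ht =>
    exact .starOr _ _ A B (by simp [hf, hl]) (binary_contrPlace h b (by simp [hl]) hB)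
      (hstar l h1) (by simpa using h2) (by simpa using ht)
  | star hl hs hr ht =>
    refine .star (by simp [hf, hl]) (hempty (by simp [hl]) hs) ?_ (by simpa using ht)
    obtain ⟨u, hu⟩ := Option.ne_none_iff_exists'.1 hr
    obtain ⟨c, hc⟩ := exists_pr_contrPlace (S₁ := S₁) (ρ := ρ) (X := X) (s := s) (E := E) b hu
    rw [LabelledForest.IsRoot, hc]
    exact Option.some_ne_none _
  | cut l r A hl hr hlr hs h1 h2 hA hA' ht =>
    refine .cut (contrPlace G X s E b l) (contrPlace G X s E b r) A (by simp [hf, hl]) ?_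
      ((contrPlace_injective b).ne hlr) ?_ (by simpa using h1) (by simpa using h2) hA hA'
      (by simpa using ht)
    · by_cases hD : v ∈ Doubled X s E
      · rw [contrPlace_of_mem hD]
        exact pr_copy_eq_none hD hr fun hw ↦ by simpa [hl, Label.IsWitness] using hw.2.2
      · rw [contrPlace_of_notMem hD, LabelledForest.IsRoot, pr_keep,
          show G.pr v = none from hr, Option.map_none]
    · rw [succs_contrPlace h b (by simp [hl]), hs, Set.image_pair]

theorem wellTypedAt_sum (h : IsContractible G X s t S₁ E) {w : V} (hw : w ∈ RootWitness G E) :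
    (contrReduct G X s S₁ E ρ).WellTypedAt (.sum w hw) := by
  obtain ⟨τ, hτ, hτw⟩ := (h.typed.wellTyped w).exists_isWitness hw.2.2
  refine .plus τ rfl ⟨.copy .L w (Or.inl hw.1), pr_copy_rootWitness _ hw⟩ hτw ?_ ?_
  · intro y hy
    obtain ⟨b, rfl⟩ := eq_copy_of_pr_sum hy
    exact hτ
  · change (G.ty w).map _ = _
    rw [hτ]; rfl

theorem wireIn_of_pos {F : LabelledForest P W V} {A : Set V} {v : V} {x : W} (hv : v ∈ A)
    (hl : F.label v = .pos x) : F.WireIn A x := ⟨v, hv, Or.inl hl⟩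

theorem wireIn_of_neg {F : LabelledForest P W V} {A : Set V} {v : V} {x : W} (hv : v ∈ A)
    (hl : F.label v = .neg x) : F.WireIn A x := ⟨v, hv, Or.inr hl⟩

/-- A positive wire of the reduct is a kept wire or a renamed copy of a wire of `E`. -/
theorem label_eq_pos (h : IsContractible G X s t S₁ E) {y : ContrNode G X s E} {x : W}
    (hy : (contrReduct G X s S₁ E ρ).label y = .pos x) :
    (∃ v hv, y = .keep v hv ∧ G.label v = .pos x) ∨
      ∃ b v, ∃ hv : v ∈ E, ∃ x₀, y = .copy b v (Or.inl hv) ∧ G.label v = .pos x₀ ∧ ρ b x₀ = x := by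
  rcases y with ⟨v, hv⟩ | ⟨b, v, hv⟩ | ⟨w, hw⟩
  · exact Or.inl ⟨v, hv, rfl, hy⟩
  · rw [label_copy, Label.rename_eq_pos] at hy
    obtain ⟨x₀, hl, hx⟩ := hy
    exact Or.inr ⟨b, v, h.mem_of_label_pos hv hl, x₀, rfl, hl, hx⟩
  · simp [label_sum] at hy

/-- A negative wire of the reduct is a kept wire or a renamed copy of a wire of `E`. -/
theorem label_eq_neg (h : IsContractible G X s t S₁ E) {y : ContrNode G X s E} {x : W}
    (hy : (contrReduct G X s S₁ E ρ).label y = .neg x) :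
    (∃ v hv, y = .keep v hv ∧ G.label v = .neg x) ∨
      ∃ b v, ∃ hv : v ∈ E, ∃ x₀, y = .copy b v (Or.inl hv) ∧ G.label v = .neg x₀ ∧ ρ b x₀ = x := by
  rcases y with ⟨v, hv⟩ | ⟨b, v, hv⟩ | ⟨w, hw⟩
  · exact Or.inl ⟨v, hv, rfl, hy⟩
  · rw [label_copy, Label.rename_eq_neg] at hy
    obtain ⟨x₀, hl, hx⟩ := hy
    exact Or.inr ⟨b, v, h.mem_of_label_neg hv hl, x₀, rfl, hl, hx⟩
  · simp [label_sum] at hy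

/-- The axiom links of the reduct lie in one of its two layers, and come from axiom links. -/
theorem exists_link (h : IsContractible G X s t S₁ E) (hρ : IsFreshRenaming G E ρ)
    {y z : ContrNode G X s E} {x : W} (hy : (contrReduct G X s S₁ E ρ).label y = .pos x)
    (hz : (contrReduct G X s S₁ E ρ).label z = .neg x) :
    ∃ b u v x₀, y = contrPlace G X s E b u ∧ z = contrPlace G X s E b v ∧
      G.label u = .pos x₀ ∧ G.label v = .neg x₀ := by
  rcases label_eq_pos h hy with ⟨u, hu, rfl, hlu⟩ | ⟨b, u, hu, x₀, rfl, hlu, hx⟩ <;>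
    rcases label_eq_neg h hz with ⟨v, hv, rfl, hlv⟩ | ⟨c, v, hv, x₁, rfl, hlv, hx'⟩
  · exact ⟨.L, u, v, x, (contrPlace_of_notMem hu).symm, (contrPlace_of_notMem hv).symm, hlu, hlv⟩
  · exact (hρ.fresh c x₁ (wireIn_of_neg hv hlv)
      (hx' ▸ wireIn_of_pos (Set.mem_univ _) hlu)).elim
  · exact (hρ.fresh b x₀ (wireIn_of_pos hu hlu)
      (hx ▸ wireIn_of_neg (Set.mem_univ _) hlv)).elim
  · obtain ⟨rfl, rfl⟩ := hρ.inj b c x₀ x₁ (wireIn_of_pos hu hlu) (wireIn_of_neg hv hlv)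
      (hx.trans hx'.symm)
    exact ⟨b, u, v, x₀, (contrPlace_of_mem _).symm, (contrPlace_of_mem _).symm, hlu, hlv⟩

theorem isTypedForest_contrReduct (h : IsContractible G X s t S₁ E)
    (hρ : IsFreshRenaming G E ρ) : (contrReduct G X s S₁ E ρ).IsTypedForest where
  finite := have := h.typed.finite; finite_contrNode
  forest := isForest_contrReduct h
  wellTyped := by
    rintro (⟨v, hv⟩ | ⟨b, v, hv⟩ | ⟨w, hw⟩)
    · rw [← contrPlace_of_notMem (b := .L) hv]; exact wellTypedAt_contrPlace h _ _
    · rw [← contrPlace_of_mem (b := b) hv]; exact wellTypedAt_contrPlace h _ _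
    · exact wellTypedAt_sum h hw
  pos_unique := by
    intro y z x hy hz
    rcases label_eq_pos h hy with ⟨u, hu, rfl, hlu⟩ | ⟨b, u, hu, x₀, rfl, hlu, hx⟩ <;>
      rcases label_eq_pos h hz with ⟨v, hv, rfl, hlv⟩ | ⟨c, v, hv, x₁, rfl, hlv, hx'⟩
    · obtain rfl := h.typed.pos_unique u v x hlu hlv; rfl
    · exact (hρ.fresh c x₁ (wireIn_of_pos hv hlv)
        (hx' ▸ wireIn_of_pos (Set.mem_univ _) hlu)).elim
    · exact (hρ.fresh b x₀ (wireIn_of_pos hu hlu)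
        (hx ▸ wireIn_of_pos (Set.mem_univ _) hlv)).elim
    · obtain ⟨rfl, rfl⟩ := hρ.inj b c x₀ x₁ (wireIn_of_pos hu hlu) (wireIn_of_pos hv hlv)
        (hx.trans hx'.symm)
      obtain rfl := h.typed.pos_unique u v x₀ hlu hlv; rfl
  neg_unique := by
    intro y z x hy hz
    rcases label_eq_neg h hy with ⟨u, hu, rfl, hlu⟩ | ⟨b, u, hu, x₀, rfl, hlu, hx⟩ <;>
      rcases label_eq_neg h hz with ⟨v, hv, rfl, hlv⟩ | ⟨c, v, hv, x₁, rfl, hlv, hx'⟩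
    · obtain rfl := h.typed.neg_unique u v x hlu hlv; rfl
    · exact (hρ.fresh c x₁ (wireIn_of_neg hv hlv)
        (hx' ▸ wireIn_of_neg (Set.mem_univ _) hlu)).elim
    · exact (hρ.fresh b x₀ (wireIn_of_neg hu hlu)
        (hx ▸ wireIn_of_neg (Set.mem_univ _) hlv)).elim
    · obtain ⟨rfl, rfl⟩ := hρ.inj b c x₀ x₁ (wireIn_of_neg hu hlu) (wireIn_of_neg hv hlv)
        (hx.trans hx'.symm)
      obtain rfl := h.typed.neg_unique u v x₀ hlu hlv; rfl
  paired := by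
    intro x
    constructor
    · rintro ⟨y, hy⟩
      rcases label_eq_pos h hy with ⟨u, hu, rfl, hl⟩ | ⟨b, u, hu, x₀, rfl, hl, rfl⟩
      · obtain ⟨v, hv⟩ := (h.typed.paired x).1 ⟨u, hl⟩
        exact ⟨.keep v fun hD ↦ hu ((h.mem_doubled_iff_of_link hl hv).2 hD), hv⟩
      · obtain ⟨v, hv⟩ := (h.typed.paired x₀).1 ⟨u, hl⟩
        exact ⟨.copy b v (Or.inl ((h.subnet.1.links u v x₀ hl hv).1 hu)),
          (label_copy _).trans (hv ▸ rfl)⟩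
    · rintro ⟨y, hy⟩
      rcases label_eq_neg h hy with ⟨u, hu, rfl, hl⟩ | ⟨b, u, hu, x₀, rfl, hl, rfl⟩
      · obtain ⟨v, hv⟩ := (h.typed.paired x).2 ⟨u, hl⟩
        exact ⟨.keep v fun hD ↦ hu ((h.mem_doubled_iff_of_link hv hl).1 hD), hv⟩
      · obtain ⟨v, hv⟩ := (h.typed.paired x₀).2 ⟨u, hl⟩
        exact ⟨.copy b v (Or.inl ((h.subnet.1.links v u x₀ hv hl).2 hu)),
          (label_copy _).trans (hv ▸ rfl)⟩

theorem dualWireTypes_contrReduct (h : IsContractible G X s t S₁ E)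
    (hρ : IsFreshRenaming G E ρ) (hG : G.DualWireTypes) :
    (contrReduct G X s S₁ E ρ).DualWireTypes := by
  intro y z x hy hz
  obtain ⟨b, u, v, x₀, rfl, rfl, hu, hv⟩ := exists_link h hρ hy hz
  simpa using hG u v x₀ hu hv

/-! ### The type of the reduct -/

/-- A typed root of the reduct is a kept root, with its type, or a new expansion `(w^L + w^R)`
over a root witness `w`: the roots among the copies are cuts. -/
theorem closureOf_contrReduct (h : IsContractible G X s t S₁ E) :
    (contrReduct G X s S₁ E ρ).ClosureOf G := by
  have key : ∀ y : (contrReduct G X s S₁ E ρ).TypedRoot,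
      (∃ v hv, y.1 = .keep v hv ∧ G.IsRoot v ∧ G.label v ≠ .cut) ∨ ∃ w hw, y.1 = .sum w hw := by
    rintro ⟨⟨v, hv⟩ | ⟨b, v, hv⟩ | ⟨w, hw⟩, hr, hl⟩
    · rw [LabelledForest.IsRoot, pr_keep, Option.map_eq_none_iff] at hr
      exact Or.inl ⟨v, hv, rfl, hr, hl⟩
    · exfalso
      rcases hp : G.pr v with _ | u
      · rcases h.of_pr_none hp hv with hc | hw
        · exact hl (by rw [label_copy, hc]; rfl)
        · rw [LabelledForest.IsRoot, pr_copy_rootWitness hv hw] at hr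
          cases hr
      · rw [LabelledForest.IsRoot, pr_copy hv hp] at hr
        cases hr
    · exact Or.inr ⟨w, hw, rfl⟩
  have hroot : ∀ y : (contrReduct G X s S₁ E ρ).TypedRoot,
      G.IsRoot y.1.origin ∧ G.label y.1.origin ≠ .cut := by
    intro y
    rcases key y with ⟨v, hv, hy, hr⟩ | ⟨w, hw, hy⟩
    · rw [hy]; exact hr
    · rw [hy]; exact ⟨hw.2.1, fun hc ↦ by
        have := hw.2.2
        simp only [ContrNode.origin] at hc
        rw [hc] at this; exact this⟩
  refine ⟨fun y ↦ ⟨y.1.origin, hroot y⟩, ?_, ?_⟩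
  · intro y z hyz
    have hyz' : y.1.origin = z.1.origin := congrArg Subtype.val hyz
    apply Subtype.ext
    rcases key y with ⟨v, hv, hy, -⟩ | ⟨w, hw, hy⟩ <;>
      rcases key z with ⟨v', hv', hz, -⟩ | ⟨w', hw', hz⟩ <;>
      rw [hy, hz] at hyz' ⊢ <;> simp only [ContrNode.origin] at hyz' <;> subst hyz'
    · rfl
    · exact (hv (Or.inl hw'.1)).elim
    · exact (hv' (Or.inl hw.1)).elim
    · rfl
  · intro y
    rcases key y with ⟨v, hv, hy, -, hl⟩ | ⟨w, hw, hy⟩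
    · have hty : (contrReduct G X s S₁ E ρ).ty y.1 = G.ty y.1.origin := by rw [hy]; rfl
      have hne : ∃ τ, G.ty y.1.origin = some τ := by
        have hr := (hroot y).1
        have hl := (hroot y).2
        cases h.typed.wellTyped y.1.origin <;> first | exact ⟨_, ‹_›⟩ | contradiction
      obtain ⟨τ, hτ⟩ := hne
      exact ⟨τ, τ, hty.trans hτ, hτ, Or.inl rfl⟩
    · obtain ⟨τ, hτ, -⟩ := (h.typed.wellTyped w).exists_isWitness hw.2.2
      refine ⟨.formula τ.underlying, τ, ?_, ?_, Or.inr rfl⟩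
      · rw [hy]
        change (G.ty w).map _ = _
        rw [hτ]; rfl
      · change G.ty y.1.origin = _
        rw [hy]; exact hτ

/-! ### Switchings of the reduct -/

/-- The switching of the original forest that a switching of the reduct induces through its layer
`b`, which consists of the kept nodes and the `b`-copies. -/
noncomputable def layerSwitching (b : Side) (σ : ContrNode G X s E → ContrNode G X s E) (v : V) :
    V :=
  (σ (contrPlace G X s E b v)).origin

theorem switched_contrPlace (h : IsContractible G X s t S₁ E) (b : Side) {v : V}
    (hv : G.Switched v) : (contrReduct G X s S₁ E ρ).Switched (contrPlace G X s E b v) := by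
  obtain ⟨f, hf⟩ := exists_label_contrPlace (S₁ := S₁) (ρ := ρ) (G := G) (X := X) (s := s)
    (E := E) b v
  rcases hv with hv | ⟨hv, hs⟩
  · exact Or.inl (by rw [hf, hv]; rfl)
  · refine Or.inr ⟨by rw [hf, hv]; rfl, ?_⟩
    rw [succs_contrPlace h b (by simp [hv])]
    rintro _ ⟨u, hu, rfl⟩
    obtain ⟨g, hg⟩ := exists_label_contrPlace (S₁ := S₁) (ρ := ρ) (G := G) (X := X) (s := s)
      (E := E) b u
    rw [hg, Ne, Label.rename_eq_star]
    exact hs u hu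

theorem isSwitching_layerSwitching (h : IsContractible G X s t S₁ E) (b : Side)
    {σ : ContrNode G X s E → ContrNode G X s E}
    (hσ : (contrReduct G X s S₁ E ρ).IsSwitching σ) : G.IsSwitching (layerSwitching b σ) :=
  fun _ hv ↦ (eq_contrPlace_of_pr (hσ _ (switched_contrPlace h b hv))).1

theorem switchEdge_of_contrPlace (h : IsContractible G X s t S₁ E)
    (hρ : IsFreshRenaming G E ρ) {b : Side} {σ : ContrNode G X s E → ContrNode G X s E} {u v : V}
    (huv : (contrReduct G X s S₁ E ρ).SwitchEdge σ (contrPlace G X s E b u)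
      (contrPlace G X s E b v)) : G.SwitchEdge (layerSwitching b σ) u v := by
  rcases huv with ⟨hp, hσ⟩ | ⟨x, hu, hv⟩
  · refine Or.inl ⟨by simpa using (eq_contrPlace_of_pr hp).1, fun hv ↦ ?_⟩
    rw [layerSwitching, hσ (switched_contrPlace h b hv), origin_contrPlace]
  · obtain ⟨c, u', v', x₀, hu', hv', hlu, hlv⟩ := exists_link h hρ hu hv
    have h1 := congrArg ContrNode.origin hu'
    have h2 := congrArg ContrNode.origin hv'
    rw [origin_contrPlace, origin_contrPlace] at h1 h2
    exact Or.inr ⟨x₀, h1 ▸ hlu, h2 ▸ hlv⟩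

/-- Each layer of a switching graph of the reduct is a subgraph of a switching graph of the
original forest. -/
theorem adj_of_contrPlace (h : IsContractible G X s t S₁ E) (hρ : IsFreshRenaming G E ρ)
    {b : Side} {σ : ContrNode G X s E → ContrNode G X s E} {u v : V}
    (huv : ((contrReduct G X s S₁ E ρ).switchingGraph σ).Adj (contrPlace G X s E b u)
      (contrPlace G X s E b v)) : (G.switchingGraph (layerSwitching b σ)).Adj u v := by
  rw [LabelledForest.switchingGraph_adj] at huv ⊢
  exact ⟨fun e ↦ huv.1 (e ▸ rfl), huv.2.imp (switchEdge_of_contrPlace h hρ)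
    (switchEdge_of_contrPlace h hρ)⟩

/-- The neighbours of a new expansion `(w^L + w^R)` in a switching graph: only the chosen copy
of `w`. -/
theorem adj_sum {σ : ContrNode G X s E → ContrNode G X s E} {w : V} {hw : w ∈ RootWitness G E}
    {y : ContrNode G X s E}
    (hy : ((contrReduct G X s S₁ E ρ).switchingGraph σ).Adj (.sum w hw) y) :
    σ (.sum w hw) = y ∧ ∃ b, y = .copy b w (Or.inl hw.1) := by
  obtain ⟨-, (⟨hp, -⟩ | ⟨x, hl, -⟩) | (⟨hp, hσ⟩ | ⟨x, -, hl⟩)⟩ :=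
    LabelledForest.switchingGraph_adj.1 hy
  · simp [pr_sum] at hp
  · simp [label_sum] at hl
  · exact ⟨hσ (Or.inl rfl), eq_copy_of_pr_sum hp⟩
  · simp [label_sum] at hl

/-- The edges of a switching graph of the reduct that leave the `b`-copies: those that join the
copy of a root witness of `E` to the expansion it belongs to, and the one that joins the copy of
`s` to the witness chosen there. -/
theorem adj_copy (h : IsContractible G X s t S₁ E) (hρ : IsFreshRenaming G E ρ)
    {σ : ContrNode G X s E → ContrNode G X s E} {b : Side} {v : V} {hv : v ∈ Doubled X s E}
    {y : ContrNode G X s E}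
    (hy : ((contrReduct G X s S₁ E ρ).switchingGraph σ).Adj (.copy b v hv) y)
    (hne : ∀ z hz, y ≠ .copy b z hz) :
    ((contrReduct G X s S₁ E ρ).pr (.copy b v hv) = some y ∧ σ y = .copy b v hv) ∨
      (v = s ∧ G.pr y.origin = some s ∧ σ (.copy b v hv) = y) := by
  have hlink : ∀ {x y z}, (contrReduct G X s S₁ E ρ).label y = .pos x →
      (contrReduct G X s S₁ E ρ).label z = .neg x →
      ((∃ v hv, y = .copy b v hv) ↔ ∃ v hv, z = .copy b v hv) := by
    intro x y z hly hlz
    obtain ⟨c, u, v, x₀, rfl, rfl, hlu, hlv⟩ := exists_link h hρ hly hlz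
    have hiff := h.mem_doubled_iff_of_link hlu hlv
    by_cases hu : u ∈ Doubled X s E
    · rw [contrPlace_of_mem hu, contrPlace_of_mem (hiff.1 hu)]
      constructor
      · rintro ⟨v', hv', e⟩
        obtain ⟨rfl, rfl⟩ := by simpa using e
        exact ⟨v, hiff.1 hu, rfl⟩
      · rintro ⟨v', hv', e⟩
        obtain ⟨rfl, rfl⟩ := by simpa using e
        exact ⟨u, hu, rfl⟩
    · rw [contrPlace_of_notMem hu, contrPlace_of_notMem (mt hiff.2 hu)]
      constructor <;> rintro ⟨_, _, e⟩ <;> cases e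
  obtain ⟨-, (⟨hp, hσ⟩ | ⟨x, hl, hl'⟩) | (⟨hp, hσ⟩ | ⟨x, hl', hl⟩)⟩ :=
    LabelledForest.switchingGraph_adj.1 hy
  · refine Or.inl ⟨hp, hσ ?_⟩
    rcases y with ⟨u, hu⟩ | ⟨c, u, hu⟩ | ⟨w, hw⟩
    · refine Or.inl ?_
      rw [← contrPlace_of_notMem (b := .L) hu] at hp
      exact (h.of_pr_notMem_doubled (eq_contrPlace_of_pr hp).1 hv hu).2.2
    · rcases hpv : G.pr v with _ | u'
      · by_cases hw : v ∈ RootWitness G E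
        · simp [pr_copy_rootWitness hv hw] at hp
        · simp [pr_copy_eq_none hv hpv hw] at hp
      · rw [pr_copy hv hpv] at hp
        by_cases hu' : u' ∈ Doubled X s E
        · rw [contrPlace_of_mem hu', Option.some.injEq] at hp
          exact (hne _ _ hp.symm).elim
        · simp [contrPlace_of_notMem hu'] at hp
    · exact Or.inl rfl
  · obtain ⟨z, hz, e⟩ := (hlink hl hl').1 ⟨v, hv, rfl⟩
    exact (hne z hz e).elim
  · have hp' := hp
    rw [← contrPlace_of_mem (b := b) hv] at hp'
    obtain ⟨hpy, c, hc⟩ := eq_contrPlace_of_pr hp'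
    by_cases hvs : v = s
    · subst hvs
      exact Or.inr ⟨rfl, hpy, hσ (switched_contrPlace h b h.switched_s |> fun hs ↦ by
        rwa [contrPlace_of_mem hv] at hs)⟩
    · have hD := h.mem_doubled_of_pr hpy hv hvs
      rw [contrPlace_of_mem hD] at hc
      rw [hc, pr_copy hD hpy, contrPlace_of_mem hv, Option.some.injEq] at hp
      obtain rfl : c = b := by simpa using hp
      exact (hne _ _ hc).elim
  · obtain ⟨z, hz, e⟩ := (hlink hl' hl).2 ⟨v, hv, rfl⟩
    exact (hne z hz e).elim

/-! ### Acyclicity of the reduct -/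

/-- The edge that joins the copy of a root witness `w` of `E` to an expansion outside the copies
lies on no cycle. If the expansion is kept, the cut that shows this is the set of kept nodes that
are joined to it by kept nodes: an edge from this set to another copied node would give a switching
path outside `E` from `w` to another root of `E`, possibly to `t` through `s` and the cut. -/
theorem notMem_edges_of_pr_copy (h : IsContractible G X s t S₁ E) (hρ : IsFreshRenaming G E ρ)
    {σ : ContrNode G X s E → ContrNode G X s E}
    (hσ : (contrReduct G X s S₁ E ρ).IsSwitching σ) {v : ContrNode G X s E}
    {c : ((contrReduct G X s S₁ E ρ).switchingGraph σ).Walk v v} (hc : c.IsCycle)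
    {b : Side} {w : V} {hw : w ∈ Doubled X s E} {y : ContrNode G X s E}
    (hp : (contrReduct G X s S₁ E ρ).pr (.copy b w hw) = some y)
    (hy : ∀ b z hz, y ≠ .copy b z hz) (hσy : σ y = .copy b w hw) :
    s(.copy b w hw, y) ∉ c.edges := by
  intro hmem
  rcases y with ⟨u, hu⟩ | ⟨c, u, hu⟩ | ⟨w', hw'⟩
  · have hwu : G.pr w = some u := by
      rw [← contrPlace_of_notMem (b := .L) hu] at hp
      exact (eq_contrPlace_of_pr hp).1
    obtain ⟨hroot, hwt, hplus⟩ := h.of_pr_notMem_doubled hwu hw hu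
    let K := ((contrReduct G X s S₁ E ρ).switchingGraph σ).comap
      fun z : {z : V // z ∉ Doubled X s E} ↦ ContrNode.keep z.1 z.2
    -- The kept part of the switching graph embeds in both induced switching graphs.
    have hwalk : ∀ d (z z' : {z : V // z ∉ Doubled X s E}), K.Reachable z z' →
        ∃ q : (G.switchingGraph (layerSwitching d σ)).Walk z.1 z'.1,
          ∀ a ∈ q.support, a ∉ Doubled X s E := by
      rintro d z z' ⟨q⟩
      let φ : K →g G.switchingGraph (layerSwitching d σ) := ⟨Subtype.val, fun {a a'} haa' ↦ by
        refine adj_of_contrPlace h hρ (b := d) ?_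
        rw [contrPlace_of_notMem a.2, contrPlace_of_notMem a'.2]
        exact haa'⟩
      refine ⟨q.map φ, ?_⟩
      intro a ha
      rw [SimpleGraph.Walk.support_map, List.mem_map] at ha
      obtain ⟨a', -, rfl⟩ := ha
      exact a'.2
    have hadj : ∀ d, (G.switchingGraph (layerSwitching d σ)).Adj w u := by
      refine fun d ↦ h.typed.forest.switchingGraph_adj_of_pr hwu fun _ ↦ ?_
      rw [layerSwitching, contrPlace_of_notMem hu, hσy]; rfl
    let D : Set (ContrNode G X s E) :=
      {z | ∃ a, ∃ ha : a ∉ Doubled X s E, z = .keep a ha ∧ K.Reachable ⟨u, hu⟩ ⟨a, ha⟩}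
    obtain ⟨a', ⟨a, ha, rfl, hua⟩, b', hb', hab, hne⟩ := exists_crossing_edge_ne hc D
      (a := .keep u hu) (b := .copy b w hw) ⟨u, hu, rfl, .refl _⟩ (by rintro ⟨_, _, e, -⟩; cases e)
      (by rwa [Sym2.eq_swap])
    have hab' : ((contrReduct G X s S₁ E ρ).switchingGraph σ).Adj (.keep a ha) b' :=
      c.adj_of_mem_edges hab
    rcases b' with ⟨v', hv'⟩ | ⟨d, v', hv'⟩ | ⟨w', hw'⟩
    · refine hb' ⟨v', hv', rfl, hua.trans ?_⟩
      exact SimpleGraph.Adj.reachable (G := K) hab'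
    · obtain ⟨q, hq⟩ := hwalk d _ _ hua
      have hqE : ∀ z ∈ q.support, z ∉ E := fun z hz hzE ↦ hq z hz (Or.inl hzE)
      rcases adj_copy h hρ hab'.symm nofun with ⟨hp', hσa⟩ | ⟨rfl, hpa, hσs⟩
      · have hv'a : G.pr v' = some a := by
          rw [← contrPlace_of_notMem (b := .L) ha] at hp'
          exact (eq_contrPlace_of_pr hp').1
        obtain ⟨hroot', -, -⟩ := h.of_pr_notMem_doubled hv'a hv' ha
        by_cases hwv : w = v'
        · subst hwv
          obtain rfl : u = a := by simpa [hwu] using hv'a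
          rw [hσy] at hσa
          exact hne (by rw [hσa])
        · refine h.subnet.not_walk_outside (isSwitching_layerSwitching h d hσ) hroot hroot' hwv
            (hadj d) ?_ q hqE
          refine (h.typed.forest.switchingGraph_adj_of_pr hv'a fun _ ↦ ?_).symm
          rw [layerSwitching, contrPlace_of_notMem ha, hσa]; rfl
      · have h1 : (G.switchingGraph (layerSwitching d σ)).Adj a v' := by
          refine h.typed.forest.switchingGraph_adj_of_pr hpa fun _ ↦ ?_
          rw [layerSwitching, contrPlace_of_mem hv', hσs]; rfl
        have h2 := h.typed.forest.switchingGraph_adj_of_pr (σ := layerSwitching d σ) h.pr_s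
          (fun hX ↦ (h.not_switched_X hX).elim)
        have h3 := h.typed.forest.switchingGraph_adj_of_pr (σ := layerSwitching d σ) h.pr_t
          (fun hX ↦ (h.not_switched_X hX).elim)
        refine h.subnet.not_walk_outside (isSwitching_layerSwitching h d hσ) hroot h.root_t hwt
          (hadj d) h3.symm ((q.concat h1).concat h2) ?_
        intro z hz
        rw [SimpleGraph.Walk.support_concat, SimpleGraph.Walk.support_concat] at hz
        simp only [List.mem_append, List.mem_singleton] at hz
        rcases hz with (hz | rfl) | rfl
        exacts [hqE z hz, h.s_notMem, h.X_notMem]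
    · obtain ⟨-, d, e⟩ := adj_sum hab'.symm
      cases e
  · exact hy c u hu rfl
  · obtain ⟨a, rfl, b', hb', hab, hne⟩ := exists_crossing_edge_ne hc {.sum w' hw'}
      (a := .sum w' hw') (b := .copy b w hw) rfl (by simp) (by rwa [Sym2.eq_swap])
    obtain ⟨hσ', -⟩ := adj_sum (c.adj_of_mem_edges hab)
    rw [hσy] at hσ'
    exact hne (by rw [hσ'])

/-- A cycle in a switching graph of the reduct does not leave the copies on one side: the only
edge out of them that is not excluded otherwise starts at the copy of `s`, and a cycle would have
to cross a second one. -/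
theorem copy_copy_of_mem_edges (h : IsContractible G X s t S₁ E) (hρ : IsFreshRenaming G E ρ)
    {σ : ContrNode G X s E → ContrNode G X s E}
    (hσ : (contrReduct G X s S₁ E ρ).IsSwitching σ) {v : ContrNode G X s E}
    {c : ((contrReduct G X s S₁ E ρ).switchingGraph σ).Walk v v} (hc : c.IsCycle)
    {b : Side} {w : V} {hw : w ∈ Doubled X s E} {y : ContrNode G X s E}
    (hmem : s(.copy b w hw, y) ∈ c.edges) : ∃ z hz, y = .copy b z hz := by
  by_contra! hy
  have key : ∀ {w hw y}, s(.copy b w hw, y) ∈ c.edges → (∀ z hz, y ≠ .copy b z hz) →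
      w = s ∧ σ (.copy b w hw) = y := by
    intro w hw y hmem hy
    rcases adj_copy h hρ (c.adj_of_mem_edges hmem) hy with ⟨hp, hσy⟩ | ⟨hws, -, hσw⟩
    · refine (notMem_edges_of_pr_copy h hρ hσ hc hp ?_ hσy hmem).elim
      rintro d z hz rfl
      -- The predecessor of a `b`-copy is never a copy on the other side.
      rw [← contrPlace_of_mem (b := d) hz] at hp
      obtain ⟨hpw, -⟩ := eq_contrPlace_of_pr hp
      rw [pr_copy hw hpw, Option.some.injEq, contrPlace_of_mem hz, contrPlace_of_mem hz] at hp
      exact hy z hz hp.symm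
    · exact ⟨hws, hσw⟩
  obtain ⟨hws, hσw⟩ := key hmem hy
  obtain ⟨a, ⟨w', hw', rfl⟩, b', hb', hab, hne⟩ := exists_crossing_edge_ne hc
    {z | ∃ w hw, z = .copy b w hw} ⟨w, hw, rfl⟩ (by rintro ⟨z, hz, e⟩; exact hy z hz e) hmem
  obtain ⟨hws', hσw'⟩ := key hab fun z hz e ↦ hb' ⟨z, hz, e⟩
  subst hws hws'
  exact hne (by rw [← hσw, ← hσw'])

theorem ac_contrReduct (h : IsContractible G X s t S₁ E) (hρ : IsFreshRenaming G E ρ) :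
    (contrReduct G X s S₁ E ρ).AC := by
  intro σ hσ v c hc
  -- A cycle that stays in one layer would be a cycle of the original forest.
  have hlayer : ∀ b, ¬ ∀ z ∈ c.support, z ∈ Set.range (contrPlace G X s E b) := fun b hsup ↦
    not_isCycle_of_support_subset_range (h.ac _ (isSwitching_layerSwitching h b hσ))
      (fun _ _ ↦ adj_of_contrPlace h hρ) c hsup hc
  rcases v with ⟨v, hv⟩ | ⟨b, v, hv⟩ | ⟨w, hw⟩
  · have hsup : ∀ z ∈ c.support, z ∈ {z | ∃ a ha, z = .keep a ha} := by
      refine support_subset_of_forall_not_crossing c ⟨v, hv, rfl⟩ ?_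
      rintro _ ⟨a, ha, rfl⟩ (⟨u, hu⟩ | ⟨d, u, hu⟩ | ⟨w, hw⟩) hb hab
      · exact hb ⟨u, hu, rfl⟩
      · rw [Sym2.eq_swap] at hab
        obtain ⟨_, _, e⟩ := copy_copy_of_mem_edges h hρ hσ hc hab
        cases e
      · obtain ⟨-, d, e⟩ := adj_sum (c.adj_of_mem_edges hab).symm
        cases e
    refine hlayer .L fun z hz ↦ ?_
    obtain ⟨a, ha, rfl⟩ := hsup z hz
    exact ⟨a, contrPlace_of_notMem ha⟩
  · have hsup : ∀ z ∈ c.support, z ∈ {z | ∃ a ha, z = .copy b a ha} := by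
      refine support_subset_of_forall_not_crossing c ⟨v, hv, rfl⟩ ?_
      rintro _ ⟨a, ha, rfl⟩ y hb hab
      exact hb (copy_copy_of_mem_edges h hρ hσ hc hab)
    refine hlayer b fun z hz ↦ ?_
    obtain ⟨a, ha, rfl⟩ := hsup z hz
    exact ⟨a, contrPlace_of_mem ha⟩
  · cases c with
    | nil => simp at hc
    | cons hadj q =>
      obtain ⟨-, b, rfl⟩ := adj_sum hadj
      obtain ⟨_, _, e⟩ := copy_copy_of_mem_edges h hρ hσ hc (b := b) (w := w)
        (hw := Or.inl hw.1) (y := .sum w hw) (by simp [Sym2.eq_swap])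
      cases e

end

end ExpansionNet

theorem mainTheorem4 {P W V : Type*} (G : ExpansionNet.LabelledForest P W V)
    (hG : G.IsTypedForest) (hAC : G.AC)
    (X s t : V) (hX : G.label X = .cut) (hs : G.label s = .plus)
    (hst : s ≠ t) (hXs : G.pr s = some X) (hXt : G.pr t = some X)
    (S₁ S₂ : Set V) (hS : S₁ ∪ S₂ = G.succs s) (hdisj : Disjoint S₁ S₂)
    (hS₁ : S₁.Nonempty) (hS₂ : S₂.Nonempty)
    (E : Set V) (hE : G.IsSubnet E) (ht : G.IsRootOf E t)
    (hroots : ∀ r, G.IsRootOf E r → r ≠ t → (G.label r).IsWitness ∨ G.label r = .cut)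
    (ρ : ExpansionNet.Side → W → W) (hρ : ExpansionNet.IsFreshRenaming G E ρ) :
    (ExpansionNet.contrReduct G X s S₁ E ρ).IsTypedForest ∧
      (ExpansionNet.contrReduct G X s S₁ E ρ).AC ∧
      (ExpansionNet.contrReduct G X s S₁ E ρ).ClosureOf G ∧
      (G.DualWireTypes → (ExpansionNet.contrReduct G X s S₁ E ρ).DualWireTypes) := by
  have h : ExpansionNet.IsContractible G X s t S₁ E :=
    { typed := hG
      ac := hAC
      label_X := hX
      label_s := hs
      ne := hst
      pr_s := hXs
      pr_t := hXt
      left_nonempty := hS₁.imp fun a ha ↦ ⟨ha, hS.subset (Or.inl ha)⟩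
      right_nonempty := hS₂.imp fun a ha ↦
        ⟨Set.disjoint_right.1 hdisj ha, hS.subset (Or.inr ha)⟩
      subnet := hE
      root_t := ht
      roots := hroots }
  exact ⟨ExpansionNet.isTypedForest_contrReduct h hρ, ExpansionNet.ac_contrReduct h hρ,
    ExpansionNet.closureOf_contrReduct h, ExpansionNet.dualWireTypes_contrReduct h hρ⟩
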